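/- Let $E$ be a real Banach space with dual $E^*$, closed unit ball $B_E$, dual unit ball $B_{E^*}$ and dual unit sphere $S_{E^*}$. Suppose that $B_{E^*}$ with the weak$^*$-topology is convex block compact, i.e. for every sequence $(x_n^*)_{n\in\mathbb N}$ in $B_{E^*}$ there are pairwise disjoint finite sets $A_n\subset\mathbb N$ and real numbers $\lambda_k\ge 0$ with $\sum_{k\in A_n}\lambda_k=1$ for every $n$ such that the sequence $y_n^*=\sum_{k\in A_n}\lambda_k x_k^*$ is weak$^*$-convergent to an element of $B_{E^*}$. Suppose that there are $\alpha\in\mathbb R$ and a convex weakly compact set $D\subset E$ such that the set $$P=\{x^*\in S_{E^*} : \sup_{x\in D} x^*(x)<\alpha\}$$ is nonempty and every $x^*\in P$ is norm-attaining, i.e. there is $x\in B_E$ with $x^*(x)=\|x^*\|$. (If $D=\emptyset$, the supremum is read as $-\infty$.) Then $E$ is reflexive, i.e. the canonical embedding $E\to E^{**}$ is onto. -/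

import Mathlib

/-- `y` is a convex block subsequence of `x`: each `y n` is a convex combination of the `x k`,
`k ∈ A n`, with pairwise disjoint finite sets `A n` of indices. -/
def IsConvexBlockSubseq {V : Type*} [AddCommGroup V] [Module ℝ V] (x y : ℕ → V) : Prop :=
  ∃ (A : ℕ → Finset ℕ) (c : ℕ → ℝ),
    (∀ m n, m ≠ n → Disjoint (A m) (A n)) ∧
    (∀ k, 0 ≤ c k) ∧
    (∀ n, ∑ k ∈ A n, c k = 1) ∧
    (∀ n, y n = ∑ k ∈ A n, c k • x k)

/-- Every sequence in `C` has a convex block subsequence that converges to an element of `C`. -/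
def IsConvexBlockCompact {V : Type*} [AddCommGroup V] [Module ℝ V] [TopologicalSpace V]
    (C : Set V) : Prop :=
  ∀ x : ℕ → V, (∀ n, x n ∈ C) →
    ∃ y : ℕ → V, IsConvexBlockSubseq x y ∧
      ∃ z ∈ C, Filter.Tendsto y Filter.atTop (nhds z)

/-- The closed unit ball of the dual of `E`, as a subset of the dual with the weak* topology. -/
def weakStarDualBall (E : Type*) [NormedAddCommGroup E] [NormedSpace ℝ E] :
    Set (WeakDual ℝ E) :=
  WeakDual.toStrongDual ⁻¹' Metric.closedBall (0 : StrongDual ℝ E) 1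

/-- Compactness in the weak topology. -/
def IsWeaklyCompact {E : Type*} [NormedAddCommGroup E] [NormedSpace ℝ E] (D : Set E) : Prop :=
  IsCompact (toWeakSpace ℝ E '' D)

/-- The functional `f` attains its norm on the closed unit ball of `E`. -/
def IsNormAttaining {E : Type*} [NormedAddCommGroup E] [NormedSpace ℝ E]
    (f : StrongDual ℝ E) : Prop :=
  ∃ x ∈ Metric.closedBall (0 : E) 1, f x = ‖f‖

/-- The supremum of `f` on `D` in the extended reals (`-∞` if `D` is empty). -/
noncomputable def supOn {E : Type*} [NormedAddCommGroup E] [NormedSpace ℝ E]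
    (f : StrongDual ℝ E) (D : Set E) : EReal :=
  ⨆ x ∈ D, ((f x : ℝ) : EReal)

/-- The canonical embedding of `E` into its bidual is onto. -/
def IsReflexiveSpace (E : Type*) [NormedAddCommGroup E] [NormedSpace ℝ E] : Prop :=
  Function.Surjective (NormedSpace.inclusionInDoubleDual ℝ E)

/-! Suppose `E` is not reflexive. Applying Goldstine's theorem twice, James' construction gives f_n
and x_n in the unit balls with f_k(x_n) ≥ θ for k ≤ n and f_n(x_j) → 0 for each j. A weak*
convergent convex block sequence of (f_n), minus its limit, is a weak* null sequence z whose convex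
combinations all have norm at least θ (`exists_weakStar_null_sequence_of_not_reflexive`).

The engine is `simons_inequality`, used twice. Over the weakly compact set D it gives convex
combinations w_n of tails of z with w_n ≤ 1/(n+1) on D. Next, start at f₀ ∈ P and move along tails
of w: `exists_scale_norm_add_smul` provides t and g_n such that all convex combinations of f_n = f₀
+ t g_n have norm between 1+η and 1+2η. For small η, far out in the sequence, these combinations and
their norm limits lie in the cone generated by P, so they attain their norms.

Simons' inequality over the unit ball now applies: suprema at least 1+η force an upper limit at
least 1+η at points of the ball. But f_n → f₀ pointwise and f₀ ≤ 1 on the ball, a contradiction. -/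

/-- The supremum of a functional over a set, as a real number. -/
noncomputable def supVal {E : Type*} [NormedAddCommGroup E] [NormedSpace ℝ E]
    (Y : Set E) (g : StrongDual ℝ E) : ℝ :=
  sSup ((fun y => g y) '' Y)

section supVal

variable {E : Type*} [NormedAddCommGroup E] [NormedSpace ℝ E] {Y : Set E} {R : ℝ}

theorem le_supVal (hR : ∀ y ∈ Y, ‖y‖ ≤ R) (g : StrongDual ℝ E) {y : E} (hy : y ∈ Y) :
    g y ≤ supVal Y g := by
  refine le_csSup ⟨‖g‖ * R, ?_⟩ ⟨y, hy, rfl⟩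
  rintro _ ⟨z, hz, rfl⟩
  exact (le_abs_self _).trans ((g.le_opNorm z).trans
    (mul_le_mul_of_nonneg_left (hR z hz) (norm_nonneg _)))

theorem supVal_le (hY : Y.Nonempty) {g : StrongDual ℝ E} {b : ℝ} (h : ∀ y ∈ Y, g y ≤ b) :
    supVal Y g ≤ b := by
  refine csSup_le (hY.image _) ?_
  rintro _ ⟨z, hz, rfl⟩
  exact h z hz

theorem supVal_le_add_norm (hY : Y.Nonempty) (hR : ∀ y ∈ Y, ‖y‖ ≤ R) (g h : StrongDual ℝ E) :
    supVal Y g ≤ supVal Y h + ‖g - h‖ * R := by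
  refine supVal_le hY fun y hy => ?_
  have h1 := le_supVal hR h hy
  have h2 : (g - h) y ≤ ‖g - h‖ * R := (le_abs_self _).trans (((g - h).le_opNorm y).trans
    (mul_le_mul_of_nonneg_left (hR y hy) (norm_nonneg _)))
  rw [sub_apply] at h2
  linarith

end supVal

/-! ### Bounds that pass to convex hulls -/

theorem apply_le_of_mem_convexHull {E : Type*} [NormedAddCommGroup E] [NormedSpace ℝ E]
    {s : Set (StrongDual ℝ E)} {y : E} {b : ℝ} (h : ∀ g ∈ s, g y ≤ b)
    {g : StrongDual ℝ E} (hg : g ∈ convexHull ℝ s) : g y ≤ b := by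
  have hc : Convex ℝ {g : StrongDual ℝ E | g y ≤ b} :=
    convex_halfSpace_le ⟨fun _ _ => rfl, fun _ _ => rfl⟩ b
  exact convexHull_min h hc hg

theorem le_apply_of_mem_convexHull {E : Type*} [NormedAddCommGroup E] [NormedSpace ℝ E]
    {s : Set (StrongDual ℝ E)} {y : E} {b : ℝ} (h : ∀ g ∈ s, b ≤ g y)
    {g : StrongDual ℝ E} (hg : g ∈ convexHull ℝ s) : b ≤ g y := by
  have hc : Convex ℝ {g : StrongDual ℝ E | b ≤ g y} :=
    convex_halfSpace_ge ⟨fun _ _ => rfl, fun _ _ => rfl⟩ b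
  exact convexHull_min h hc hg

theorem norm_le_of_mem_convexHull {V : Type*} [NormedAddCommGroup V] [NormedSpace ℝ V]
    {s : Set V} {C : ℝ} (h : ∀ g ∈ s, ‖g‖ ≤ C) {g : V} (hg : g ∈ convexHull ℝ s) : ‖g‖ ≤ C := by
  have := convexHull_min (t := Metric.closedBall (0 : V) C) (fun g hg => by simpa using h g hg)
    (convex_closedBall _ _) hg
  simpa using this

/-! ### Simons' inequality -/

/-- The partial sums of `∑ lam ^ p • g p`, where `g p` is chosen by `G` from the preceding partial
sum. -/
def greedySum {V : Type*} [AddCommGroup V] [Module ℝ V] (lam : ℝ) (G : ℕ → V → V) : ℕ → V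
  | 0 => 0
  | n + 1 => greedySum lam G n + lam ^ n • G n (greedySum lam G n)

/-- **Simons' inequality**: a bounded sequence of functionals whose convex combinations have
supremum at least `m` over `Y`, attained for each element of the closed convex hull, has upper limit
at least `m` at points of `Y`. -/
theorem simons_inequality {E : Type*} [NormedAddCommGroup E] [NormedSpace ℝ E]
    {Y : Set E} (hY : Y.Nonempty) {R : ℝ} (hR : ∀ y ∈ Y, ‖y‖ ≤ R)
    {f : ℕ → StrongDual ℝ E} {C : ℝ} (hf : ∀ n, ‖f n‖ ≤ C)
    (hatt : ∀ g ∈ closure (convexHull ℝ (Set.range f)), ∃ y ∈ Y, ∀ x ∈ Y, g x ≤ g y)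
    {c m : ℝ} (hlim : ∀ y ∈ Y, ∀ c' > c, ∀ᶠ n in Filter.atTop, f n y ≤ c')
    (hm : ∀ g ∈ convexHull ℝ (Set.range f), ∃ y ∈ Y, m ≤ g y) : m ≤ c := by
  by_contra! hcm
  obtain ⟨y₀, hy₀⟩ := hY
  have hY : Y.Nonempty := ⟨y₀, hy₀⟩
  have hR0 : 0 ≤ R := (norm_nonneg _).trans (hR y₀ hy₀)
  have hC0 : 0 ≤ C := (norm_nonneg _).trans (hf 0)
  set S := supVal Y with hS
  set M := C * R with hM
  have hM0 : 0 ≤ M := mul_nonneg hC0 hR0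
  set K : ℕ → Set (StrongDual ℝ E) := fun n => convexHull ℝ (f '' Set.Ici n) with hK
  have hKc : ∀ n, Convex ℝ (K n) := fun n => convex_convexHull ℝ _
  have hKmono : ∀ n, K (n + 1) ⊆ K n := fun n =>
    convexHull_mono (Set.image_mono (Set.Ici_subset_Ici.2 n.le_succ))
  have hKne : ∀ n, (K n).Nonempty := fun n => ⟨f n, subset_convexHull ℝ _ ⟨n, Set.self_mem_Ici, rfl⟩⟩
  have hKsub : ∀ n, K n ⊆ convexHull ℝ (Set.range f) := fun n =>
    convexHull_mono (Set.image_subset_range _ _)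
  have hKnorm : ∀ n, ∀ g ∈ K n, ‖g‖ ≤ C := fun n g hg =>
    norm_le_of_mem_convexHull (by rintro _ ⟨k, -, rfl⟩; exact hf k) hg
  have hKM : ∀ n, ∀ g ∈ K n, ∀ y ∈ Y, |g y| ≤ M := fun n g hg y hy =>
    (g.le_opNorm y).trans (mul_le_mul (hKnorm n g hg) (hR y hy) (norm_nonneg _) hC0)
  -- the parameters
  obtain ⟨δ, hδ, hδm⟩ : ∃ δ > 0, m - 3 * δ = c + δ := ⟨(m - c) / 4, by linarith, by ring⟩
  -- The last condition amounts to lam (M - m + 3δ) ≤ δ; it is what `hgy` needs in order to lose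
  -- only one further δ.
  obtain ⟨lam, hl0, hl1, hlam⟩ : ∃ lam : ℝ, 0 < lam ∧ lam < 1 ∧
      (m - 3 * δ) * (1 - lam) ≤ m - 2 * δ - lam * M := by
    have hden : 0 < M + |m| + 3 * δ + 1 := by positivity
    refine ⟨δ / (M + |m| + 3 * δ + 1), by positivity, ?_, ?_⟩
    · rw [div_lt_one hden]; linarith [abs_nonneg m]
    · have h1 : δ / (M + |m| + 3 * δ + 1) * (M + |m| + 3 * δ + 1) = δ :=
        div_mul_cancel₀ _ hden.ne'
      have h2 : 0 < δ / (M + |m| + 3 * δ + 1) := by positivity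
      nlinarith [mul_nonneg h2.le (by linarith [neg_abs_le m] : (0 : ℝ) ≤ m + |m| + 1)]
  have hl1' : 0 < 1 - lam := by linarith
  -- the greedy choice
  have hchoice : ∀ (n : ℕ) (s : StrongDual ℝ E), ∃ g ∈ K n, ∀ h ∈ K n,
      S (s + lam ^ n • g) ≤ S (s + lam ^ n • h) + δ * (lam / 2) ^ (n + 1) := by
    intro n s
    set T := (fun h => S (s + lam ^ n • h)) '' K n with hT
    have hTb : BddBelow T := by
      refine ⟨s y₀ - lam ^ n * M, ?_⟩
      rintro _ ⟨h, hh, rfl⟩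
      have h1 : (s + lam ^ n • h) y₀ ≤ S (s + lam ^ n • h) := le_supVal hR _ hy₀
      have h2 := (abs_le.1 (hKM n h hh y₀ hy₀)).1
      have h3 : (s + lam ^ n • h) y₀ = s y₀ + lam ^ n * h y₀ := rfl
      have h4 : 0 < lam ^ n := by positivity
      change s y₀ - lam ^ n * M ≤ S (s + lam ^ n • h)
      nlinarith
    obtain ⟨_, ⟨g, hg, rfl⟩, hlt⟩ := exists_lt_of_csInf_lt ((hKne n).image _)
      (lt_add_of_pos_right (sInf T) (by positivity : 0 < δ * (lam / 2) ^ (n + 1)))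
    refine ⟨g, hg, fun h hh => ?_⟩
    have := csInf_le hTb ⟨h, hh, rfl⟩
    change S (s + lam ^ n • g) < _ at hlt
    change _ ≤ S (s + lam ^ n • h) at this
    linarith
  choose G hGK hG using hchoice
  set s := greedySum lam G with hs
  set g : ℕ → StrongDual ℝ E := fun n => G n (s n) with hg
  have hgK : ∀ n, g n ∈ K n := fun n => hGK n (s n)
  have hs0 : s 0 = 0 := rfl
  have hs1 : ∀ n, s (n + 1) = s n + lam ^ n • g n := fun n => rfl
  -- increments
  have hconv : ∀ n, (1 + lam) * S (s (n + 1)) ≤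
      lam * S (s n) + S (s (n + 2)) + (1 + lam) * (δ * (lam / 2) ^ (n + 1)) := by
    intro n
    -- This competitor of `g n` moves `s n` to (s_n lam + s_{n+2}) / (1 + lam), so near-minimality
    -- together with convexity of S compares consecutive increments.
    have hmem : (1 / (1 + lam)) • g n + (lam / (1 + lam)) • g (n + 1) ∈ K n :=
      hKc n (hgK n) (hKmono n (hgK (n + 1))) (by positivity) (by positivity) (by field_simp)
    have h1 := hG n (s n) _ hmem
    have h2 : S (s n + lam ^ n • ((1 / (1 + lam)) • g n + (lam / (1 + lam)) • g (n + 1))) ≤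
        (lam * S (s n) + S (s (n + 2))) / (1 + lam) := by
      refine supVal_le hY fun y hy => ?_
      have h3 := le_supVal hR (s n) hy
      have h4 := le_supVal hR (s (n + 2)) hy
      rw [le_div_iff₀ (by positivity)]
      have h5 : (s (n + 2)) y = s n y + lam ^ n * g n y + lam ^ (n + 1) * g (n + 1) y := rfl
      have h6 : (s n + lam ^ n • ((1 / (1 + lam)) • g n + (lam / (1 + lam)) • g (n + 1))) y =
        s n y + lam ^ n * (1 / (1 + lam) * g n y + lam / (1 + lam) * g (n + 1) y) := rfl
      have h7 : (s n y + lam ^ n * (1 / (1 + lam) * g n y + lam / (1 + lam) * g (n + 1) y)) *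
          (1 + lam) = lam * s n y + s (n + 2) y := by
        rw [h5]; field_simp; ring
      rw [h6, h7]
      have := mul_le_mul_of_nonneg_left h3 hl0.le
      change _ ≤ lam * supVal Y (s n) + supVal Y (s (n + 2))
      linarith
    have h8 : (lam * S (s n) + S (s (n + 2))) / (1 + lam) * (1 + lam) =
      lam * S (s n) + S (s (n + 2)) := div_mul_cancel₀ _ (by positivity)
    have h9 : S (s (n + 1)) ≤ (lam * S (s n) + S (s (n + 2))) / (1 + lam) +
      δ * (lam / 2) ^ (n + 1) := h1.trans (by linarith)
    have := mul_le_mul_of_nonneg_right h9 (by linarith : (0 : ℝ) ≤ 1 + lam)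
    linarith
  -- By `hconv` an increment of S is at least lam times the preceding one, up to an error. The
  -- factor lam/2 in the tolerance makes the errors, divided by lam^n, a geometric series with sum
  -- at most 2δ.
  have hinc : ∀ n, lam ^ n * (m - 2 * δ * (1 - (1 / 2) ^ n)) ≤ S (s (n + 1)) - S (s n) := by
    intro n
    induction n with
    | zero =>
      have h0 : S (s 0) ≤ 0 := supVal_le hY fun y _ => by rw [hs0]; simp
      obtain ⟨y, hy, hmy⟩ := hm _ (hKsub 0 (hgK 0))
      have h1 : s 1 y ≤ S (s 1) := le_supVal hR _ hy
      have h2 : s 1 y = g 0 y := by rw [hs1, hs0]; simp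
      simp only [pow_zero, sub_self, mul_zero, sub_zero, one_mul, zero_add]
      linarith
    | succ n ih =>
      have h1 := hconv n
      have h2 := mul_le_mul_of_nonneg_left ih hl0.le
      have h3 : (1 + lam) * (δ * (lam / 2) ^ (n + 1)) ≤ 2 * (δ * (lam / 2) ^ (n + 1)) :=
        mul_le_mul_of_nonneg_right (by linarith) (by positivity)
      have h4 : lam ^ (n + 1) * (m - 2 * δ * (1 - (1 / 2) ^ (n + 1))) =
          lam * (lam ^ n * (m - 2 * δ * (1 - (1 / 2) ^ n))) - 2 * (δ * (lam / 2) ^ (n + 1)) := by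
        rw [div_pow, div_pow, div_pow]; simp only [one_pow]; field_simp; ring
      rw [h4]
      linarith
  have hinc' : ∀ n, lam ^ n * (m - 2 * δ) ≤ S (s (n + 1)) - S (s n) := fun n => by
    refine le_trans (mul_le_mul_of_nonneg_left ?_ (by positivity)) (hinc n)
    have : (0 : ℝ) < (1 / 2) ^ n := by positivity
    nlinarith
  have htel : ∀ n j, (m - 2 * δ) * (lam ^ n - lam ^ (n + j)) ≤
      (1 - lam) * (S (s (n + j)) - S (s n)) := by
    intro n j
    induction j with
    | zero => simp
    | succ j ih =>
      have h1 := mul_le_mul_of_nonneg_left (hinc' (n + j)) hl1'.le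
      have h2 : (m - 2 * δ) * (lam ^ n - lam ^ (n + (j + 1))) =
        (m - 2 * δ) * (lam ^ n - lam ^ (n + j)) +
          (1 - lam) * (lam ^ (n + j) * (m - 2 * δ)) := by ring
      rw [h2, ← add_assoc]
      linarith
  have htail : ∀ y ∈ Y, ∀ n j, (1 - lam) * (s (n + j) y - s n y) ≤
      M * (lam ^ n - lam ^ (n + j)) := by
    intro y hy n j
    induction j with
    | zero => simp
    | succ j ih =>
      have h1 : s (n + (j + 1)) y = s (n + j) y + lam ^ (n + j) * g (n + j) y := rfl
      have h2 := (abs_le.1 (hKM _ _ (hgK (n + j)) y hy)).2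
      have h3 := mul_le_mul_of_nonneg_left h2
        (mul_nonneg hl1'.le (by positivity : (0 : ℝ) ≤ lam ^ (n + j)))
      have h4 : M * (lam ^ n - lam ^ (n + (j + 1))) = M * (lam ^ n - lam ^ (n + j)) +
        (1 - lam) * lam ^ (n + j) * M := by ring
      rw [h1, h4]
      linarith
  -- the limit
  have hsum : Summable fun n => lam ^ n • g n := by
    refine Summable.of_norm_bounded ((summable_geometric_of_lt_one hl0.le hl1).mul_right C) ?_
    intro n
    rw [norm_smul, Real.norm_of_nonneg (by positivity)]
    exact mul_le_mul_of_nonneg_left (hKnorm n _ (hgK n)) (by positivity)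
  obtain ⟨t, ht⟩ := hsum
  have hst : Filter.Tendsto s Filter.atTop (nhds t) := by
    have h1 : ∀ n, s n = ∑ p ∈ Finset.range n, lam ^ p • g p := by
      intro n
      induction n with
      | zero => rfl
      | succ n ih => rw [Finset.sum_range_succ, ← ih, hs1]
    simpa only [← h1] using ht.tendsto_sum_nat
  have hpow : Filter.Tendsto (fun n : ℕ => lam ^ n) Filter.atTop (nhds 0) :=
    tendsto_pow_atTop_nhds_zero_of_lt_one hl0.le hl1
  have hmem : (1 - lam) • t ∈ closure (convexHull ℝ (Set.range f)) := by
    -- The weights (1 - lam) lam^p for p < n, together with lam^n, sum to 1; the term in h pads the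
    -- truncated series to a convex combination.
    have h1 : ∀ n, ∀ h ∈ K 0, (1 - lam) • s n + lam ^ n • h ∈ K 0 := by
      intro n
      induction n with
      | zero => intro h hh; simpa [hs0] using hh
      | succ n ih =>
        intro h hh
        have hgn : g n ∈ K 0 :=
          convexHull_mono (Set.image_mono (Set.Ici_subset_Ici.2 n.zero_le)) (hgK n)
        have := ih _ (hKc 0 hgn hh hl1'.le hl0.le (by ring))
        convert this using 1
        rw [hs1, pow_succ]
        module
    have h2 : Filter.Tendsto (fun n => (1 - lam) • s n + lam ^ n • f 0) Filter.atTop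
        (nhds ((1 - lam) • t + (0 : ℝ) • f 0)) :=
      (hst.const_smul _).add (hpow.smul_const _)
    rw [zero_smul, add_zero] at h2
    exact mem_closure_of_tendsto h2 (Filter.Eventually.of_forall fun n =>
      hKsub 0 (h1 n _ (subset_convexHull ℝ _ ⟨0, Set.self_mem_Ici, rfl⟩)))
  obtain ⟨y, hy, hty⟩ := hatt _ hmem
  have hty' : S t ≤ t y := supVal_le hY fun x hx => by
    have : (1 - lam) * t x ≤ (1 - lam) * t y := hty x hx
    exact le_of_mul_le_mul_left this hl1'
  have hsy : Filter.Tendsto (fun n => s n y) Filter.atTop (nhds (t y)) :=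
    ((ContinuousLinearMap.apply ℝ ℝ y).continuous.tendsto t).comp hst
  -- Since t attains S(t) at y, t(y) - s_n(y) ≥ S(t) - S(s_n), and the increments of S bound the
  -- right side below.
  have hlow : ∀ n, (m - 2 * δ) * lam ^ n ≤ (1 - lam) * (t y - s n y) := by
    intro n
    have h1 : ∀ j, (m - 2 * δ) * (lam ^ n - lam ^ (j + n)) ≤
        (1 - lam) * (t y + ‖s (j + n) - t‖ * R - s n y) := by
      intro j
      have h2 := htel n j
      rw [add_comm n j] at h2
      refine h2.trans (mul_le_mul_of_nonneg_left ?_ hl1'.le)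
      have h3 : S (s (j + n)) ≤ S t + ‖s (j + n) - t‖ * R := supVal_le_add_norm hY hR _ _
      have h4 : s n y ≤ S (s n) := le_supVal hR _ hy
      linarith
    have h5 : Filter.Tendsto (fun j => (m - 2 * δ) * (lam ^ n - lam ^ (j + n))) Filter.atTop
        (nhds ((m - 2 * δ) * (lam ^ n - 0))) :=
      (tendsto_const_nhds.sub ((Filter.tendsto_add_atTop_iff_nat n).2 hpow)).const_mul _
    have h6 : Filter.Tendsto (fun j => (1 - lam) * (t y + ‖s (j + n) - t‖ * R - s n y))
        Filter.atTop (nhds ((1 - lam) * (t y + ‖t - t‖ * R - s n y))) :=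
      (((((Filter.tendsto_add_atTop_iff_nat n).2 hst).sub_const t).norm.mul_const R).const_add
        _ |>.sub_const _).const_mul _
    have h7 := le_of_tendsto_of_tendsto' h5 h6 h1
    simpa using h7
  have hup : ∀ n, (1 - lam) * (t y - s n y) ≤ M * lam ^ n := by
    intro n
    have h1 : ∀ j, (1 - lam) * (s (j + n) y - s n y) ≤ M * lam ^ n := by
      intro j
      have h2 := htail y hy n j
      rw [add_comm n j] at h2
      have : 0 < lam ^ (j + n) := by positivity
      nlinarith
    exact le_of_tendsto' (((((Filter.tendsto_add_atTop_iff_nat n).2 hsy).sub_const _).const_mul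
      (1 - lam))) h1
  -- The lower bound on the tail from n and the upper bound on the tail from n+1 differ exactly by
  -- the term lam^n g_n(y). One point y thus serves all n, against `hlim`.
  have hgy : ∀ n, m - 3 * δ ≤ g n y := by
    intro n
    have h1 := hlow n
    have h2 := hup (n + 1)
    have h3 : s (n + 1) y = s n y + lam ^ n * g n y := rfl
    have hp : 0 < lam ^ n := by positivity
    have h4 : (m - 2 * δ - lam * M) * lam ^ n ≤ ((1 - lam) * g n y) * lam ^ n := by
      rw [h3, pow_succ] at h2
      linarith
    have h5 := le_of_mul_le_mul_right h4 hp
    have h6 : (1 - lam) * (m - 3 * δ) ≤ (1 - lam) * g n y := by linarith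
    exact le_of_mul_le_mul_left h6 hl1'
  obtain ⟨N, hN⟩ := Filter.eventually_atTop.1 (hlim y hy (c + δ / 2) (by linarith))
  have h1 : g N y ≤ c + δ / 2 := apply_le_of_mem_convexHull
    (by rintro _ ⟨k, hk, rfl⟩; exact hN k hk) (hgK N)
  have h2 := hgy N
  linarith

/-! ### Goldstine's theorem and James' sequences -/

/-- A finite form of **Goldstine's theorem**: on finitely many functionals, an element of the unit
ball of the bidual is approximated by points of the unit ball. -/
theorem exists_norm_le_one_approx_bidual {X : Type*} [NormedAddCommGroup X] [NormedSpace ℝ X]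
    {φ : StrongDual ℝ (StrongDual ℝ X)} (hφ : ‖φ‖ ≤ 1) (s : Finset (StrongDual ℝ X))
    {ε : ℝ} (hε : 0 < ε) : ∃ x : X, ‖x‖ ≤ 1 ∧ ∀ a ∈ s, |a x - φ a| < ε := by
  classical
  set T : X →ₗ[ℝ] (s → ℝ) := LinearMap.pi fun a => (a : StrongDual ℝ X).toLinearMap with hT
  set v : s → ℝ := fun a => φ a with hv
  have hv_mem : v ∈ closure (T '' Metric.closedBall 0 1) := by
    by_contra hnot
    obtain ⟨l, u, hlu, hul⟩ := geometric_hahn_banach_closed_point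
      (((convex_closedBall (0 : X) 1).linear_image T).closure) isClosed_closure hnot
    -- The separating functional on the finite product, pulled back to X; then ‖b‖ ≤ u < φ(b),
    -- against ‖φ‖ ≤ 1.
    set b : StrongDual ℝ X := ∑ a : s, l (Pi.single a 1) • (a : StrongDual ℝ X) with hb
    have hl : ∀ w : s → ℝ, l w = ∑ a, w a * l (Pi.single a 1) := fun w => by
      conv_lhs => rw [pi_eq_sum_univ' w]
      simp [map_sum]
    have hbx : ∀ x, b x = l (T x) := fun x => by
      rw [hl, hb]; simp [hT, mul_comm]
    have hφb : φ b = l v := by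
      rw [hl, hb]; simp [hv, mul_comm]
    have hlt : ∀ x : X, ‖x‖ ≤ 1 → b x < u := fun x hx => by
      rw [hbx]; exact hlu _ (subset_closure ⟨x, by simpa using hx, rfl⟩)
    have hu : 0 < u := by simpa using hlt 0 (by simp)
    have hbu : ‖b‖ ≤ u := by
      refine ContinuousLinearMap.opNorm_le_of_unit_norm hu.le fun x hx => abs_le.2 ⟨?_, ?_⟩
      · have := hlt (-x) (by rw [norm_neg, hx])
        rw [map_neg] at this
        linarith
      · exact (hlt x hx.le).le
    have h1 : φ b ≤ ‖φ‖ * ‖b‖ := (le_abs_self _).trans (φ.le_opNorm b)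
    have h2 : ‖φ‖ * ‖b‖ ≤ 1 * ‖b‖ := mul_le_mul_of_nonneg_right hφ (norm_nonneg _)
    linarith
  obtain ⟨_, ⟨x, hx, rfl⟩, hd⟩ := Metric.mem_closure_iff.1 hv_mem ε hε
  refine ⟨x, by simpa using hx, fun a ha => ?_⟩
  have h1 := (dist_le_pi_dist v (T x) ⟨a, ha⟩).trans_lt hd
  rw [Real.dist_eq, abs_sub_comm] at h1
  exact h1

set_option maxSynthPendingDepth 5 in
/-- A proper complete subspace, the canonical image of a non-reflexive space in its bidual, is
annihilated by a nonzero functional. -/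
theorem exists_separating_functional_of_not_reflexive {E : Type*} [NormedAddCommGroup E]
    [NormedSpace ℝ E] [CompleteSpace E] (h : ¬ IsReflexiveSpace E) :
    ∃ (F : StrongDual ℝ (StrongDual ℝ (StrongDual ℝ E))) (φ : StrongDual ℝ (StrongDual ℝ E)),
      ‖F‖ ≤ 1 ∧ ‖φ‖ ≤ 1 ∧ 0 < F φ ∧
        ∀ x : E, F (NormedSpace.inclusionInDoubleDual ℝ E x) = 0 := by
  unfold IsReflexiveSpace Function.Surjective at h
  push Not at h
  obtain ⟨φ, hφ⟩ := h
  set J := NormedSpace.inclusionInDoubleDual ℝ E with hJ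
  have hclosed : IsClosed (Set.range J) :=
    (NormedSpace.inclusionInDoubleDualLi (E := E)
      ℝ).isometry.isUniformInducing.isComplete_range.isClosed
  have hconv : Convex ℝ (Set.range J) := by
    rw [← Set.image_univ]
    exact convex_univ.linear_image J.toLinearMap
  obtain ⟨F, u, hFu, huF⟩ := geometric_hahn_banach_closed_point hconv hclosed
    (x := φ) (by rintro ⟨x, hx⟩; exact hφ x hx)
  have hF0 : ∀ x, F (J x) = 0 := by
    intro x
    by_contra hne
    have := hFu _ ⟨((u + 1) / F (J x)) • x, rfl⟩
    rw [map_smul, map_smul, smul_eq_mul, div_mul_cancel₀ _ hne] at this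
    linarith
  have hFφ : 0 < F φ := by
    have := hFu _ ⟨0, rfl⟩
    rw [map_zero, map_zero] at this
    linarith
  have hφ0 : φ ≠ 0 := by rintro rfl; simp at hFφ
  have hF0' : F ≠ 0 := by rintro rfl; simp at hFφ
  have h1 : 0 < ‖φ‖ := norm_pos_iff.2 hφ0
  have h2 : 0 < ‖F‖ := norm_pos_iff.2 hF0'
  refine ⟨‖F‖⁻¹ • F, ‖φ‖⁻¹ • φ, ?_, ?_, ?_, fun x => ?_⟩
  · rw [norm_smul, norm_inv, norm_norm, inv_mul_cancel₀ h2.ne']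
  · rw [norm_smul, norm_inv, norm_norm, inv_mul_cancel₀ h1.ne']
  · rw [map_smul, smul_apply]
    simp only [smul_eq_mul]
    positivity
  · rw [smul_apply, hF0, smul_zero]

set_option maxSynthPendingDepth 5 in
/-- **James' sequences** in a non-reflexive Banach space. -/
theorem exists_james_sequences {E : Type*} [NormedAddCommGroup E] [NormedSpace ℝ E]
    [CompleteSpace E] (h : ¬ IsReflexiveSpace E) :
    ∃ θ > 0, ∃ (f : ℕ → StrongDual ℝ E) (x : ℕ → E), (∀ n, ‖f n‖ ≤ 1) ∧ (∀ n, ‖x n‖ ≤ 1) ∧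
      (∀ k n, k ≤ n → θ ≤ f k (x n)) ∧
      ∀ j, Filter.Tendsto (fun n => f n (x j)) Filter.atTop (nhds 0) := by
  classical
  obtain ⟨F, φ, hF, hφ, hpos, hFJ⟩ := exists_separating_functional_of_not_reflexive h
  set θ := F φ with hθ
  -- A triple carries a functional, a point and a counter. The counter strictly increases, so the
  -- tolerance for earlier points tends to 0. Each new functional approximates F on φ and on earlier
  -- points, where F vanishes; each new point approximates φ on all functionals so far.
  obtain ⟨q, hq, hr⟩ := exists_seq_of_forall_finset_exists
    (α := StrongDual ℝ E × E × ℕ)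
    (fun p => ‖p.1‖ ≤ 1 ∧ ‖p.2.1‖ ≤ 1 ∧ 3 * θ / 4 ≤ φ p.1 ∧ θ / 2 ≤ p.1 p.2.1)
    (fun p p' => p.2.2 < p'.2.2 ∧ |p'.1 p.2.1| ≤ 1 / ((p'.2.2 : ℝ) + 1) ∧ θ / 2 ≤ p.1 p'.2.1)
    (by
      intro s hs
      set k := s.sup (fun p => p.2.2) + 1 with hk
      obtain ⟨f, hf1, hf⟩ := exists_norm_le_one_approx_bidual hF
        (insert φ (s.image fun p => NormedSpace.inclusionInDoubleDual ℝ E p.2.1))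
        (lt_min (by positivity : 0 < θ / 4) (by positivity : 0 < 1 / ((k : ℝ) + 1)))
      have hφf : 3 * θ / 4 ≤ φ f := by
        have := (abs_lt.1 (lt_of_lt_of_le (hf φ (Finset.mem_insert_self _ _))
          (min_le_left _ _))).1
        linarith
      obtain ⟨x, hx1, hx⟩ := exists_norm_le_one_approx_bidual hφ
        (insert f (s.image fun p => p.1)) (by positivity : 0 < θ / 4)
      refine ⟨(f, x, k), ⟨hf1, hx1, hφf, ?_⟩, fun p hp => ⟨?_, ?_, ?_⟩⟩
      · have := (abs_lt.1 (hx f (Finset.mem_insert_self _ _))).1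
        change θ / 2 ≤ f x
        linarith
      · exact Nat.lt_succ_of_le (Finset.le_sup (f := fun p : StrongDual ℝ E × E × ℕ => p.2.2) hp)
      · have := (hf _ (Finset.mem_insert_of_mem (Finset.mem_image_of_mem _ hp))).le.trans
          (min_le_right _ _)
        rwa [hFJ, sub_zero, NormedSpace.dual_def] at this
      · have h1 := (abs_lt.1 (hx p.1 (Finset.mem_insert_of_mem (Finset.mem_image_of_mem _ hp)))).1
        have h2 := (hs p hp).2.2.1
        change θ / 2 ≤ p.1 x
        linarith)
  have hmono : StrictMono fun n => (q n).2.2 := fun m n hmn => (hr m n hmn).1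
  refine ⟨θ / 2, by positivity, fun n => (q n).1, fun n => (q n).2.1, fun n => (hq n).1,
    fun n => (hq n).2.1, fun k n hkn => ?_, fun j => ?_⟩
  · rcases hkn.eq_or_lt with rfl | hlt
    · exact (hq k).2.2.2
    · exact (hr k n hlt).2.2
  · have h1 : Filter.Tendsto (fun n => 1 / (((q n).2.2 : ℝ) + 1)) Filter.atTop (nhds 0) :=
      (tendsto_one_div_add_atTop_nhds_zero_nat (𝕜 := ℝ)).comp hmono.tendsto_atTop
    refine squeeze_zero_norm' ?_ h1
    filter_upwards [Filter.eventually_gt_atTop j] with n hn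
    exact (hr j n hn).2.1

/-! ### Convex blocks and the weak* null sequence -/

/-- The terms of a convex block subsequence are eventually convex combinations of any given tail. -/
theorem IsConvexBlockSubseq.eventually_mem_convexHull {V : Type*} [AddCommGroup V] [Module ℝ V]
    {x y : ℕ → V} (h : IsConvexBlockSubseq x y) (N : ℕ) :
    ∀ᶠ n in Filter.atTop, y n ∈ convexHull ℝ (x '' Set.Ici N) := by
  obtain ⟨A, c, hdisj, hc, hsum, hy⟩ := h
  have h1 : ∀ᶠ n in Filter.atTop, ∀ k ∈ Finset.range N, k ∉ A n := by
    rw [Filter.eventually_all_finset]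
    intro k _
    by_cases hex : ∃ m, k ∈ A m
    · obtain ⟨m, hm⟩ := hex
      filter_upwards [Filter.eventually_gt_atTop m] with n hn hk
      exact Finset.disjoint_left.1 (hdisj m n hn.ne) hm hk
    · push Not at hex
      exact Filter.Eventually.of_forall hex
  filter_upwards [h1] with n hn
  rw [hy n]
  refine (convex_convexHull ℝ _).sum_mem (fun k _ => hc k) (hsum n) fun k hk =>
    subset_convexHull ℝ _ ⟨k, ?_, rfl⟩
  by_contra hlt
  exact hn k (Finset.mem_range.2 (not_le.1 hlt)) hk

theorem abs_apply_le_of_mem_convexHull {E : Type*} [NormedAddCommGroup E] [NormedSpace ℝ E]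
    {s : Set (StrongDual ℝ E)} {y : E} {b : ℝ} (h : ∀ g ∈ s, |g y| ≤ b)
    {g : StrongDual ℝ E} (hg : g ∈ convexHull ℝ s) : |g y| ≤ b :=
  abs_le.2 ⟨le_apply_of_mem_convexHull (fun g hg => (abs_le.1 (h g hg)).1) hg,
    apply_le_of_mem_convexHull (fun g hg => (abs_le.1 (h g hg)).2) hg⟩

/-- Convex combinations of tails converge pointwise to the pointwise limit. -/
theorem tendsto_apply_of_mem_convexHull_tail {E : Type*} [NormedAddCommGroup E] [NormedSpace ℝ E]
    {f g : ℕ → StrongDual ℝ E}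
    (hg : ∀ N, ∀ᶠ n in Filter.atTop, g n ∈ convexHull ℝ (f '' Set.Ici N)) {x : E}
    (hf : Filter.Tendsto (fun n => f n x) Filter.atTop (nhds 0)) :
    Filter.Tendsto (fun n => g n x) Filter.atTop (nhds 0) := by
  rw [Metric.tendsto_atTop] at hf
  rw [Metric.tendsto_nhds]
  intro ε hε
  obtain ⟨N, hN⟩ := hf (ε / 2) (by positivity)
  filter_upwards [hg N] with n hn
  rw [Real.dist_eq, sub_zero]
  refine (abs_apply_le_of_mem_convexHull (b := ε / 2) ?_ hn).trans_lt (by linarith)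
  rintro _ ⟨k, hk, rfl⟩
  have := hN k hk
  rw [Real.dist_eq, sub_zero] at this
  exact this.le

/-- If the dual ball of a non-reflexive Banach space is weak* convex block compact, there is a
bounded weak* null sequence in the dual whose convex combinations are bounded away from zero. -/
theorem exists_weakStar_null_sequence_of_not_reflexive {E : Type*} [NormedAddCommGroup E]
    [NormedSpace ℝ E] [CompleteSpace E] (hE : IsConvexBlockCompact (weakStarDualBall E))
    (h : ¬ IsReflexiveSpace E) :
    ∃ θ > 0, ∃ z : ℕ → StrongDual ℝ E, (∀ n, ‖z n‖ ≤ 2) ∧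
      (∀ x, Filter.Tendsto (fun n => z n x) Filter.atTop (nhds 0)) ∧
      ∀ g ∈ convexHull ℝ (Set.range z), θ ≤ ‖g‖ := by
  obtain ⟨θ, hθ, f, x, hf, hx, hfx, hlim⟩ := exists_james_sequences h
  obtain ⟨y', hblock', w', hw, hyw⟩ := hE (fun n => StrongDual.toWeakDual (f n))
    (fun n => by
      change f n ∈ Metric.closedBall (0 : StrongDual ℝ E) 1
      simpa using hf n)
  set y : ℕ → StrongDual ℝ E := fun n => WeakDual.toStrongDual (y' n) with hy
  set w : StrongDual ℝ E := WeakDual.toStrongDual w' with hw'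
  have hw1 : ‖w‖ ≤ 1 := by simpa [weakStarDualBall] using hw
  have hblock : IsConvexBlockSubseq f y := by
    obtain ⟨A, c, h1, h2, h3, h4⟩ := hblock'
    exact ⟨A, c, h1, h2, h3, fun n => h4 n⟩
  have hconv : ∀ v : E, Filter.Tendsto (fun n => y n v) Filter.atTop (nhds (w v)) := fun v =>
    ((WeakDual.eval_continuous v).tendsto w').comp hyw
  have hmem := hblock.eventually_mem_convexHull
  have hwx : ∀ j, w (x j) = 0 := fun j =>
    tendsto_nhds_unique (hconv (x j)) (tendsto_apply_of_mem_convexHull_tail hmem (hlim j))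
  have hymem : ∀ n, y n ∈ convexHull ℝ (Set.range f) := by
    obtain ⟨A, c, h1, h2, h3, h4⟩ := hblock
    intro n
    rw [h4]
    exact (convex_convexHull ℝ _).sum_mem (fun k _ => h2 k) (h3 n) fun k _ =>
      subset_convexHull ℝ _ ⟨k, rfl⟩
  have hyj : ∀ n, ∃ J, ∀ j ≥ J, θ ≤ y n (x j) := by
    obtain ⟨A, c, h1, h2, h3, h4⟩ := hblock
    intro n
    refine ⟨(A n).sup id, fun j hj => ?_⟩
    have : y n ∈ convexHull ℝ (f '' (A n : Set ℕ)) := by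
      rw [h4]
      exact (convex_convexHull ℝ _).sum_mem (fun k _ => h2 k) (h3 n) fun k hk =>
        subset_convexHull ℝ _ ⟨k, hk, rfl⟩
    refine le_apply_of_mem_convexHull ?_ this
    rintro _ ⟨k, hk, rfl⟩
    exact hfx k j ((Finset.le_sup (f := id) hk).trans hj)
  refine ⟨θ, hθ, fun n => y n - w, fun n => ?_, fun v => ?_, fun g hg => ?_⟩
  · have h1 : ‖y n‖ ≤ 1 :=
      norm_le_of_mem_convexHull (by rintro _ ⟨k, rfl⟩; exact hf k) (hymem n)
    exact (norm_sub_le _ _).trans (by linarith)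
  · simpa using (hconv v).sub_const (w v)
  -- Being at least θ at all late `x j` survives convex combinations. It holds for `y n - w`,
  -- because `y n` involves finitely many `f k` and `w` vanishes at every `x j`.
  · have hset : Convex ℝ {g : StrongDual ℝ E | ∃ J, ∀ j ≥ J, θ ≤ g (x j)} := by
      rintro a ⟨J, hJ⟩ b ⟨J', hJ'⟩ p r hp hr hpr
      refine ⟨max J J', fun j hj => ?_⟩
      have h1 := mul_le_mul_of_nonneg_left (hJ j ((le_max_left _ _).trans hj)) hp
      have h2 := mul_le_mul_of_nonneg_left (hJ' j ((le_max_right _ _).trans hj)) hr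
      have h3 : (p • a + r • b) (x j) = p * a (x j) + r * b (x j) := rfl
      have h4 : p * θ + r * θ = θ := by rw [← add_mul, hpr, one_mul]
      linarith
    obtain ⟨J, hJ⟩ := convexHull_min (by
      rintro _ ⟨n, rfl⟩
      obtain ⟨J, hJ⟩ := hyj n
      refine ⟨J, fun j hj => ?_⟩
      have : (y n - w) (x j) = y n (x j) - w (x j) := rfl
      rw [this, hwx, sub_zero]
      exact hJ j hj) hset hg
    have h1 := hJ J le_rfl
    have h2 : g (x J) ≤ ‖g‖ * ‖x J‖ := (le_abs_self _).trans (g.le_opNorm _)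
    have h3 := mul_le_mul_of_nonneg_left (hx J) (norm_nonneg g)
    linarith

/-! ### Weakly compact sets -/

/-- A functional attains its supremum on a nonempty weakly compact set. -/
theorem IsWeaklyCompact.exists_isMaxOn {E : Type*} [NormedAddCommGroup E] [NormedSpace ℝ E]
    {D : Set E} (hD : IsWeaklyCompact D) (hne : D.Nonempty) (g : StrongDual ℝ E) :
    ∃ y ∈ D, ∀ x ∈ D, g x ≤ g y := by
  obtain ⟨_, ⟨y, hy, rfl⟩, hmax⟩ := IsCompact.exists_isMaxOn hD (hne.image _)
    (WeakBilin.eval_continuous (topDualPairing ℝ E).flip g).continuousOn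
  exact ⟨y, hy, fun x hx => hmax ⟨x, hx, rfl⟩⟩

/-- Each functional is bounded on D, since it and its negative attain their maxima there. Uniform
boundedness on the complete dual does the rest. -/
theorem IsWeaklyCompact.exists_norm_le {E : Type*} [NormedAddCommGroup E] [NormedSpace ℝ E]
    {D : Set E} (hD : IsWeaklyCompact D) : ∃ R, ∀ x ∈ D, ‖x‖ ≤ R := by
  rcases D.eq_empty_or_nonempty with rfl | hne
  · exact ⟨0, by simp⟩
  obtain ⟨C, hC⟩ := banach_steinhaus
    (g := fun x : D => NormedSpace.inclusionInDoubleDual ℝ E x) (fun g => by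
      obtain ⟨y, -, hy⟩ := hD.exists_isMaxOn hne g
      obtain ⟨y', -, hy'⟩ := hD.exists_isMaxOn hne (-g)
      refine ⟨max (g y) (-g y'), fun x => abs_le'.2 ⟨(hy x x.2).trans (le_max_left _ _), ?_⟩⟩
      exact (hy' x x.2).trans (le_max_right _ _))
  refine ⟨C, fun x hx => ?_⟩
  have := hC ⟨x, hx⟩
  rwa [show ‖NormedSpace.inclusionInDoubleDual ℝ E x‖ = ‖x‖ from
    (NormedSpace.inclusionInDoubleDualLi (E := E) ℝ).norm_map x] at this

/-- A bounded weak* null sequence has convex combinations that are uniformly small from above on a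
weakly compact set. -/
theorem IsWeaklyCompact.exists_mem_convexHull_apply_le {E : Type*} [NormedAddCommGroup E]
    [NormedSpace ℝ E] {D : Set E} (hD : IsWeaklyCompact D) {z : ℕ → StrongDual ℝ E} {C : ℝ}
    (hz : ∀ n, ‖z n‖ ≤ C)
    (hlim : ∀ x, Filter.Tendsto (fun n => z n x) Filter.atTop (nhds 0)) (N : ℕ) {ε : ℝ}
    (hε : 0 < ε) : ∃ g ∈ convexHull ℝ (z '' Set.Ici N), ∀ x ∈ D, g x ≤ ε := by
  rcases D.eq_empty_or_nonempty with rfl | hne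
  · exact ⟨z N, subset_convexHull ℝ _ ⟨N, Set.self_mem_Ici, rfl⟩, by simp⟩
  by_contra! hcon
  obtain ⟨R, hR⟩ := hD.exists_norm_le
  have hrange : Set.range (fun n => z (n + N)) = z '' Set.Ici N := by
    ext g
    constructor
    · rintro ⟨n, rfl⟩
      exact ⟨n + N, Nat.le_add_left _ _, rfl⟩
    · rintro ⟨n, hn, rfl⟩
      exact ⟨n - N, by simp [Nat.sub_add_cancel hn]⟩
  have := simons_inequality hne hR (f := fun n => z (n + N)) (fun n => hz _)
    (fun g _ => hD.exists_isMaxOn hne g) (c := 0) (m := ε)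
    (fun y _ c' hc' => (((Filter.tendsto_add_atTop_iff_nat N).2 (hlim y)).eventually_lt_const
      hc').mono fun _ => le_of_lt)
    (fun g hg => by
      rw [hrange] at hg
      obtain ⟨x, hx, h⟩ := hcon g hg
      exact ⟨x, hx, h.le⟩)
  linarith

/-! ### Perturbation of a functional in P -/

/-- Along the ray from `u` in the direction of the tails of a sequence whose convex combinations are
bounded away from zero, the asymptotic distance to zero takes prescribed values approximately. -/
theorem exists_scale_norm_add_smul {V : Type*} [NormedAddCommGroup V] [NormedSpace ℝ V]
    {K : ℕ → Set V} (hK : ∀ n, (K n).Nonempty) {C θ : ℝ} (hθ : 0 < θ)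
    (hC : ∀ n, ∀ g ∈ K n, ‖g‖ ≤ C) (hθK : ∀ n, ∀ g ∈ K n, θ ≤ ‖g‖) {u : V} {η : ℝ} (hη : 0 < η) :
    ∃ t : ℝ, 0 ≤ t ∧ (∃ n, ∀ g ∈ K n, ‖u‖ + η ≤ ‖u + t • g‖) ∧
      ∀ n, ∃ g ∈ K n, ‖u + t • g‖ < ‖u‖ + 2 * η := by
  classical
  have hC0 : 0 < C := by
    obtain ⟨g, hg⟩ := hK 0
    exact hθ.trans_le ((hθK 0 g hg).trans (hC 0 g hg))
  -- With this step length, raising j by one changes the norm by at most η.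
  set τ := η / C with hτ
  have hτ0 : 0 < τ := by positivity
  have hex : ∃ j : ℕ, ∃ n, ∀ g ∈ K n, ‖u‖ + η ≤ ‖u + ((j : ℝ) * τ) • g‖ := by
    obtain ⟨j, hj⟩ := exists_nat_ge ((2 * ‖u‖ + η) / (τ * θ))
    refine ⟨j, 0, fun g hg => ?_⟩
    rw [div_le_iff₀ (by positivity)] at hj
    have h1 : ‖((j : ℝ) * τ) • g‖ - ‖u‖ ≤ ‖u + ((j : ℝ) * τ) • g‖ := by
      rw [add_comm]
      exact norm_sub_le_norm_add _ _
    rw [norm_smul, Real.norm_of_nonneg (by positivity)] at h1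
    have h2 := mul_le_mul_of_nonneg_left (hθK 0 g hg) (by positivity : (0 : ℝ) ≤ j * τ)
    linarith
  -- Take the least j that works. Its predecessor fails on every `K n`, giving an element with norm
  -- below ‖u‖ + η, and one more step adds at most η.
  obtain ⟨hfind, hmin⟩ := Nat.find_spec hex, fun m => Nat.find_min hex (m := m)
  refine ⟨(Nat.find hex : ℝ) * τ, by positivity, hfind, fun n => ?_⟩
  obtain hj | ⟨j, hj⟩ : Nat.find hex = 0 ∨ ∃ j, Nat.find hex = j + 1 := by
    rcases Nat.find hex with _ | j
    · exact Or.inl rfl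
    · exact Or.inr ⟨j, rfl⟩
  · obtain ⟨g, hg⟩ := hK n
    refine ⟨g, hg, ?_⟩
    rw [hj]
    simp [hη]
  · have h1 := hmin j (by omega)
    push Not at h1
    obtain ⟨g, hg, hlt⟩ := h1 n
    refine ⟨g, hg, ?_⟩
    rw [hj]
    have h2 : u + (((j + 1 : ℕ) : ℝ) * τ) • g = (u + ((j : ℝ) * τ) • g) + τ • g := by
      push_cast
      module
    have h3 : ‖τ • g‖ ≤ η := by
      rw [norm_smul, Real.norm_of_nonneg hτ0.le]
      calc τ * ‖g‖ ≤ τ * C := mul_le_mul_of_nonneg_left (hC n g hg) hτ0.le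
        _ = η := div_mul_cancel₀ _ hC0.ne'
    rw [h2]
    linarith [norm_add_le (u + ((j : ℝ) * τ) • g) (τ • g)]

/-- Norm attainment on the part of the sphere where `supOn f D < α` propagates to the cone that this
part generates. -/
theorem exists_norm_attaining_of_sup_lt {E : Type*} [NormedAddCommGroup E] [NormedSpace ℝ E]
    {α : ℝ} {D : Set E}
    (hna : ∀ f : StrongDual ℝ E, ‖f‖ = 1 → supOn f D < (α : EReal) → IsNormAttaining f)
    {f : StrongDual ℝ E} (hf : f ≠ 0) {b : ℝ} (hb : ∀ x ∈ D, f x ≤ b) (hbα : b < α * ‖f‖) :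
    IsNormAttaining f := by
  have hpos : 0 < ‖f‖ := norm_pos_iff.2 hf
  obtain ⟨x, hx, hfx⟩ := hna (‖f‖⁻¹ • f)
    (by rw [norm_smul, norm_inv, norm_norm, inv_mul_cancel₀ hpos.ne']) (by
      have hle : supOn (‖f‖⁻¹ • f) D ≤ ((b / ‖f‖ : ℝ) : EReal) := by
        refine iSup₂_le fun x hx => EReal.coe_le_coe_iff.2 ?_
        rw [smul_apply, smul_eq_mul, inv_mul_eq_div]
        exact div_le_div_of_nonneg_right (hb x hx) hpos.le
      refine hle.trans_lt (EReal.coe_lt_coe_iff.2 ?_)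
      rwa [div_lt_iff₀ hpos])
  refine ⟨x, hx, ?_⟩
  rw [norm_smul, norm_inv, norm_norm, inv_mul_cancel₀ hpos.ne', smul_apply, smul_eq_mul,
    inv_mul_eq_div, div_eq_one_iff_eq hpos.ne'] at hfx
  exact hfx

theorem mem_convexHull_smul_of_mem_convexHull_add {V : Type*} [AddCommGroup V] [Module ℝ V]
    {s K : Set V} (hK : Convex ℝ K) {u : V} {t : ℝ} (h : ∀ v ∈ s, ∃ g ∈ K, v = u + t • g) {v : V}
    (hv : v ∈ convexHull ℝ s) : ∃ g ∈ K, v = u + t • g := by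
  have hc : Convex ℝ {v : V | ∃ g ∈ K, v = u + t • g} := by
    rintro _ ⟨g, hg, rfl⟩ _ ⟨g', hg', rfl⟩ p q hp hq hpq
    refine ⟨p • g + q • g', hK hg hg' hp hq hpq, ?_⟩
    have : u = (p + q) • u := by rw [hpq, one_smul]
    nth_rw 3 [this]
    module
  exact convexHull_min h hc hv

/-! ### The contradiction -/

theorem mainTheorem4 {E : Type*} [NormedAddCommGroup E] [NormedSpace ℝ E] [CompleteSpace E]
    (hE : IsConvexBlockCompact (weakStarDualBall E))
    (α : ℝ) (D : Set E) (hDconv : Convex ℝ D) (hDcomp : IsWeaklyCompact D)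
    (P : Set (StrongDual ℝ E))
    (hP : P = {f : StrongDual ℝ E | f ∈ Metric.sphere (0 : StrongDual ℝ E) 1 ∧
      supOn f D < (α : EReal)})
    (hPne : P.Nonempty) (hPna : ∀ f ∈ P, IsNormAttaining f) :
    IsReflexiveSpace E := by
  by_contra hnr
  obtain ⟨θ, hθ, z, hz2, hzlim, hzθ⟩ := exists_weakStar_null_sequence_of_not_reflexive hE hnr
  obtain ⟨f₀, hf₀⟩ := hPne
  rw [hP] at hf₀
  obtain ⟨hf₀1, hf₀D⟩ := hf₀
  have hu : ‖f₀‖ = 1 := by simpa using hf₀1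
  obtain ⟨β, hβ, hβα⟩ := EReal.lt_iff_exists_real_btwn.1 hf₀D
  have hβα : β < α := EReal.coe_lt_coe_iff.1 hβα
  have hf₀β : ∀ x ∈ D, f₀ x ≤ β := fun x hx =>
    EReal.coe_le_coe_iff.1 ((le_iSup₂ (f := fun x (_ : x ∈ D) => ((f₀ x : ℝ) : EReal)) x hx).trans
      hβ.le)
  have hna : ∀ f : StrongDual ℝ E, ‖f‖ = 1 → supOn f D < (α : EReal) → IsNormAttaining f :=
    fun f h1 h2 => hPna f (by rw [hP]; exact ⟨by simpa using h1, h2⟩)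
  -- combinations that are uniformly small on `D`
  have hw : ∀ n : ℕ, ∃ g ∈ convexHull ℝ (z '' Set.Ici n), ∀ x ∈ D, g x ≤ 1 / ((n : ℝ) + 1) :=
    fun n => hDcomp.exists_mem_convexHull_apply_le hz2 hzlim n (by positivity)
  choose w hwz hwD using hw
  have hwlim : ∀ x, Filter.Tendsto (fun n => w n x) Filter.atTop (nhds 0) := fun x =>
    tendsto_apply_of_mem_convexHull_tail (f := z) (fun N => by
      filter_upwards [Filter.eventually_ge_atTop N] with n hn
      exact convexHull_mono (Set.image_mono (Set.Ici_subset_Ici.2 hn)) (hwz n)) (hzlim x)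
  set K : ℕ → Set (StrongDual ℝ E) := fun n => convexHull ℝ (w '' Set.Ici n) with hK
  have hKmono : ∀ {m n}, m ≤ n → K n ⊆ K m := fun h =>
    convexHull_mono (Set.image_mono (Set.Ici_subset_Ici.2 h))
  have hKz : ∀ n, K n ⊆ convexHull ℝ (Set.range z) := fun n =>
    convexHull_min (by
      rintro _ ⟨k, -, rfl⟩
      exact convexHull_mono (Set.image_subset_range _ _) (hwz k)) (convex_convexHull ℝ _)
  have hK2 : ∀ n, ∀ g ∈ K n, ‖g‖ ≤ 2 := fun n g hg =>
    norm_le_of_mem_convexHull (by rintro _ ⟨k, rfl⟩; exact hz2 k) (hKz n hg)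
  have hKθ : ∀ n, ∀ g ∈ K n, θ ≤ ‖g‖ := fun n g hg => hzθ g (hKz n hg)
  have hKne : ∀ n, (K n).Nonempty := fun n =>
    ⟨w n, subset_convexHull ℝ _ ⟨n, Set.self_mem_Ici, rfl⟩⟩
  -- This keeps α‖v‖ ≥ α - (α - β)/4 whenever 1 ≤ ‖v‖ ≤ 1 + 2η, whatever the sign of α; that exceeds
  -- the bound (α + β)/2 available on D.
  obtain ⟨η, hη, hηα⟩ : ∃ η > 0, |α| * (2 * η) ≤ (α - β) / 4 := by
    refine ⟨(α - β) / (8 * (|α| + 1)), div_pos (by linarith) (by positivity), ?_⟩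
    have h1 : (α - β) / (8 * (|α| + 1)) * (8 * (|α| + 1)) = α - β :=
      div_mul_cancel₀ _ (by positivity)
    have h2 : 0 < (α - β) / (8 * (|α| + 1)) := div_pos (by linarith) (by positivity)
    linarith
  obtain ⟨t, ht0, ⟨N, hN⟩, htK⟩ := exists_scale_norm_add_smul hKne hθ hK2 hKθ (u := f₀) hη
  rw [hu] at hN
  simp only [hu] at htK
  -- far in the sequence, the perturbation is small on `D`
  obtain ⟨N', hNN', hN'⟩ : ∃ N' ≥ N, t * (1 / ((N' : ℝ) + 1)) ≤ (α - β) / 2 := by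
    have h1 : Filter.Tendsto (fun n : ℕ => t * (1 / ((n : ℝ) + 1))) Filter.atTop (nhds (t * 0)) :=
      tendsto_one_div_add_atTop_nhds_zero_nat.const_mul t
    rw [mul_zero] at h1
    obtain ⟨n, hn⟩ := ((Filter.eventually_ge_atTop N).and
      (h1.eventually_lt_const (by linarith : 0 < (α - β) / 2))).exists
    exact ⟨n, hn.1, hn.2.le⟩
  have hKD : ∀ g ∈ K N', ∀ x ∈ D, t * g x ≤ (α - β) / 2 := by
    intro g hg x hx
    have h1 : g x ≤ 1 / ((N' : ℝ) + 1) := by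
      refine apply_le_of_mem_convexHull ?_ hg
      rintro _ ⟨k, hk, rfl⟩
      exact (hwD k x hx).trans (one_div_le_one_div_of_le (by positivity)
        (by have : (N' : ℝ) ≤ k := Nat.cast_le.2 hk
            linarith))
    exact (mul_le_mul_of_nonneg_left h1 ht0).trans hN'
  choose g hgK hg2 using fun n => htK (n + N')
  set f : ℕ → StrongDual ℝ E := fun n => f₀ + t • g n with hf
  have hfK : ∀ v ∈ convexHull ℝ (Set.range f), ∃ h ∈ K N', v = f₀ + t • h := fun v hv =>
    mem_convexHull_smul_of_mem_convexHull_add (convex_convexHull ℝ _) (by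
      rintro _ ⟨n, rfl⟩
      exact ⟨g n, hKmono (Nat.le_add_left _ _) (hgK n), rfl⟩) hv
  have hlow : ∀ v ∈ convexHull ℝ (Set.range f), 1 + η ≤ ‖v‖ := by
    intro v hv
    obtain ⟨h, hh, rfl⟩ := hfK v hv
    exact hN h (hKmono hNN' hh)
  have hup : ∀ v ∈ convexHull ℝ (Set.range f), ‖v‖ ≤ 1 + 2 * η := fun v hv =>
    norm_le_of_mem_convexHull (by rintro _ ⟨n, rfl⟩; exact (hg2 n).le) hv
  have hDv : ∀ v ∈ convexHull ℝ (Set.range f), ∀ x ∈ D, v x ≤ β + (α - β) / 2 := by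
    intro v hv x hx
    obtain ⟨h, hh, rfl⟩ := hfK v hv
    have h1 : (f₀ + t • h) x = f₀ x + t * h x := rfl
    rw [h1]
    exact add_le_add (hf₀β x hx) (hKD h hh x hx)
  have hatt : ∀ v ∈ closure (convexHull ℝ (Set.range f)), IsNormAttaining v := by
    intro v hv
    -- The norm bounds and the bounds on D are closed conditions, so they persist on the closure.
    have h1 : 1 + η ≤ ‖v‖ := closure_minimal (t := {v : StrongDual ℝ E | 1 + η ≤ ‖v‖}) hlow
      (isClosed_le continuous_const continuous_norm) hv
    have h2 : ‖v‖ ≤ 1 + 2 * η := closure_minimal (t := {v : StrongDual ℝ E | ‖v‖ ≤ 1 + 2 * η}) hup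
      (isClosed_le continuous_norm continuous_const) hv
    have h3 : ∀ x ∈ D, v x ≤ β + (α - β) / 2 := fun x hx =>
      closure_minimal (t := {v : StrongDual ℝ E | v x ≤ β + (α - β) / 2})
        (fun v hv => hDv v hv x hx)
        (isClosed_le (ContinuousLinearMap.apply ℝ ℝ x).continuous continuous_const) hv
    refine exists_norm_attaining_of_sup_lt hna (norm_pos_iff.1 (by linarith)) h3 ?_
    have h4 : |α * (‖v‖ - 1)| ≤ |α| * (2 * η) := by
      rw [abs_mul]
      exact mul_le_mul_of_nonneg_left (abs_le.2 ⟨by linarith, by linarith⟩) (abs_nonneg _)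
    have h5 := (abs_le.1 h4).1
    linarith
  have hglim : ∀ x, Filter.Tendsto (fun n => g n x) Filter.atTop (nhds 0) := fun x =>
    tendsto_apply_of_mem_convexHull_tail (f := w) (fun M => by
      filter_upwards [Filter.eventually_ge_atTop M] with n hn
      exact hKmono (hn.trans (Nat.le_add_right _ _)) (hgK n)) (hwlim x)
  have hball : ∀ v : StrongDual ℝ E, ∀ x ∈ Metric.closedBall (0 : E) 1, v x ≤ ‖v‖ := by
    intro v x hx
    have hx1 : ‖x‖ ≤ 1 := by simpa using hx
    exact (le_abs_self _).trans ((v.le_opNorm x).trans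
      (mul_le_of_le_one_right (norm_nonneg _) hx1))
  have hfin := simons_inequality (Y := Metric.closedBall (0 : E) 1) (R := 1) (f := f)
    (C := 1 + 2 * η) (c := 1) (m := 1 + η)
    ⟨0, by simp⟩ (fun y hy => by simpa using hy) (fun n => (hg2 n).le)
    (fun v hv => by
      obtain ⟨y, hy, hvy⟩ := hatt v hv
      exact ⟨y, hy, fun x hx => hvy ▸ hball v x hx⟩)
    (fun y hy c' hc' => by
      have h1 : Filter.Tendsto (fun n => f₀ y + t * g n y) Filter.atTop (nhds (f₀ y + t * 0)) :=
        ((hglim y).const_mul t).const_add _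
      have h2 : f₀ y + t * 0 < c' := by
        have := hball f₀ y hy
        rw [hu] at this
        linarith
      exact (h1.eventually_lt_const h2).mono fun _ => le_of_lt)
    (fun v hv => by
      obtain ⟨y, hy, hvy⟩ := hatt v (subset_closure hv)
      exact ⟨y, hy, hvy ▸ hlow v hv⟩)
  linarith
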